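/- Let $\Omega\subset\mathbb R^d$ be convex, let $\mathcal M^+$ be the set of finite nonnegative Borel (hence, for Borel $\Omega$, Radon) measures on $\Omega$ (with the narrow topology) and $\mathcal M^+_2\subset\mathcal M^+$ the subset of measures with finite second moment; $|\rho|$ denotes the total mass of $\rho$. For $\mu_0,\mu_1\in\mathcal M^+$ define $\mathtt{KFR}^2(\mu_0,\mu_1)=\inf\int_0^1\int_\Omega(|v_t|^2+|r_t|^2)\,d\rho_t\,dt$ over all narrowly continuous curves $[0,1]\ni t\mapsto\rho_t\in\mathcal M^+$ from $\mu_0$ to $\mu_1$ and all fields $v,r\in L^2(0,1;L^2(d\rho_t))$ (with values in $\mathbb R^d$ and $\mathbb R$) such that $\partial_t\rho_t+\operatorname{div}(\rho_tv_t)=\rho_tr_t$ in the sense of distributions with no flux through $\partial\Omega$, i.e. $\int_0^1\int_\Omega(\partial_t\varphi+\nabla\varphi\cdot v_t+\varphi r_t)\,d\rho_t\,dt=0$ for all $\varphi\in C_c^\infty((0,1)\times\mathbb R^d)$. Let $\mathtt{FR}^2(\mu_0,\mu_1)$ be the same infimum restricted to $v\equiv0$. For $\mu_0,\mu_1\in\mathcal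 M^+_2$ with $|\mu_0|=|\mu_1|$ let $\mathtt{MK}^2(\mu_0,\mu_1)=\inf_\gamma\int_{\Omega\times\Omega}|x-y|^2\,d\gamma(x,y)$ over all nonnegative measures $\gamma$ on $\Omega\times\Omega$ with marginals $\mu_0,\mu_1$. Let $\mathcal F:\mathcal M^+\to(-\infty,+\infty]$ be a functional that is not identically $+\infty$ (for instance a proper energy $\mathcal F(\rho)=\int_\Omega\{U(\rho)+\Psi\rho+\frac12\rho K\star\rho\}\,dx$ for $\rho\ll dx$, and $+\infty$ otherwise), let $\tau>0$, and let $\rho^n\in\mathcal M_2^+$ and $\rho^{n+\frac12}$ ($n=0,1,2,\dots$) satisfy for all $n\ge0$ $$\rho^{n+\frac12}\in\operatorname*{Argmin}_{\rho\in\mathcal M_2^+,\ |\rho|=|\rho^n|}\Big\{\frac1{2\tau}\mathtt{MK}^2(\rho,\rho^n)+\mathcal F(\rho)\Big\},\qquad \rho^{n+1}\in\operatorname*{Argmin}_{\rho\in\mathcal M^+}\Big\{\frac1{2\tau}\mathtt{FR}^2(\rho,\rho^{n+\frac12})+\mathcal F(\rho)\Big\}.$$ Then, as inequalities in $[-\infty,+\infty]$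 (no assumption is made that $\mathcal F(\rho^0)<\infty$ or $\inf\mathcal F>-\infty$), $$\frac1\tau\sum_{n\ge0}\mathtt{KFR}^2(\rho^{n+1},\rho^n)\le4\Big(\mathcal F(\rho^0)-\inf_{\mathcal M^+}\mathcal F\Big)$$ and $$\frac1\tau\sum_{n\ge0}\Big\{\mathtt{FR}^2(\rho^{n+1},\rho^{n+\frac12})+\mathtt{MK}^2(\rho^{n+\frac12},\rho^n)\Big\}\le2\Big(\mathcal F(\rho^0)-\inf_{\mathcal M^+}\mathcal F\Big).$$ -/

import Mathlib

open MeasureTheory Set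
open scoped ENNReal ContDiff

namespace KFRSplitting

/-- The Euclidean space `ℝ^d`. -/
abbrev Space (d : ℕ) : Type := EuclideanSpace ℝ (Fin d)

/-- `M⁺(Ω)`: finite nonnegative Borel measures on `Ω ⊆ ℝ^d`. Mathlib's topology on this type is the
narrow one (convergence of the integrals of all bounded continuous functions on `Ω`). -/
abbrev PosMeas {d : ℕ} (Ω : Set (Space d)) : Type := FiniteMeasure Ω

/-- `M⁺₂(Ω)`: the measures in `M⁺(Ω)` with finite second moment. -/
def PosMeas2 {d : ℕ} (Ω : Set (Space d)) : Set (PosMeas Ω) :=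
  {μ | ∫⁻ x, ‖(x : Space d)‖ₑ ^ 2 ∂(μ : Measure Ω) < ⊤}

/-- The transference plans `Γ[μ₀, μ₁]`. -/
def Plans {d : ℕ} {Ω : Set (Space d)} (μ₀ μ₁ : PosMeas Ω) : Set (Measure (Ω × Ω)) :=
  {γ | γ.map Prod.fst = (μ₀ : Measure Ω) ∧ γ.map Prod.snd = (μ₁ : Measure Ω)}

/-- The squared quadratic Monge-Kantorovich distance
`MK²(μ₀, μ₁) = inf { ∫ |x - y|² dγ(x, y) : γ ∈ Γ[μ₀, μ₁] }`. -/
noncomputable def MKsq {d : ℕ} {Ω : Set (Space d)} (μ₀ μ₁ : PosMeas Ω) : ℝ≥0∞ :=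
  ⨅ γ ∈ Plans μ₀ μ₁, ∫⁻ p, ‖(p.1 : Space d) - (p.2 : Space d)‖ₑ ^ 2 ∂γ

/-- The equation `∂ₜρₜ + div(ρₜ vₜ) = ρₜ rₜ` in the sense of distributions on the open time interval
`(0,1)`: for every `φ ∈ C_c^∞((0,1) × ℝ^d)`,
`∫₀¹ ∫_Ω (∂ₜφ + ∇φ · vₜ + φ rₜ) dρₜ dt = 0`.
The test functions are restrictions to `Ω` of smooth functions on `ℝ^d` and need not vanish at the
boundary of `Ω`, so that no mass enters or leaves through that boundary. -/
def SolvesContinuityEq {d : ℕ} {Ω : Set (Space d)} (ρ : ℝ → PosMeas Ω)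
    (v : ℝ → Ω → Space d) (r : ℝ → Ω → ℝ) : Prop :=
  ∀ φ : ℝ × Space d → ℝ, ContDiff ℝ ∞ φ → HasCompactSupport φ →
    tsupport φ ⊆ Ioo (0 : ℝ) 1 ×ˢ (univ : Set (Space d)) →
    ∫ t in Ioo (0 : ℝ) 1, ∫ x : Ω,
      (fderiv ℝ φ (t, (x : Space d)) (1, 0) + fderiv ℝ φ (t, (x : Space d)) (0, v t x)
        + φ (t, (x : Space d)) * r t x) ∂(ρ t : Measure Ω) = 0

/-- The action `∫₀¹ ∫_Ω (|vₜ|² + |rₜ|²) dρₜ dt`. -/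
noncomputable def action {d : ℕ} {Ω : Set (Space d)} (ρ : ℝ → PosMeas Ω)
    (v : ℝ → Ω → Space d) (r : ℝ → Ω → ℝ) : ℝ≥0∞ :=
  ∫⁻ t in Ioo (0 : ℝ) 1, ∫⁻ x : Ω, (‖v t x‖ₑ ^ 2 + ‖r t x‖ₑ ^ 2) ∂(ρ t : Measure Ω)

/-- `(ρ, v, r)` is an admissible path from `μ₀` to `μ₁`: `t ↦ ρₜ` is narrowly continuous on `[0,1]`
with endpoints `μ₀, μ₁`, the fields `v, r` are (jointly) measurable and lie in
`L²(0,1; L²(dρₜ))`, and `∂ₜρₜ + div(ρₜ vₜ) = ρₜ rₜ`. -/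
structure IsAdmissible {d : ℕ} {Ω : Set (Space d)} (μ₀ μ₁ : PosMeas Ω) (ρ : ℝ → PosMeas Ω)
    (v : ℝ → Ω → Space d) (r : ℝ → Ω → ℝ) : Prop where
  continuousOn : ContinuousOn ρ (Icc 0 1)
  source : ρ 0 = μ₀
  target : ρ 1 = μ₁
  measurable_velocity : Measurable (Function.uncurry v)
  measurable_reaction : Measurable (Function.uncurry r)
  action_lt_top : action ρ v r < ⊤
  solves : SolvesContinuityEq ρ v r

/-- The squared Kantorovich-Fisher-Rao distance: the infimum of the action over all admissible
paths. -/
noncomputable def KFRsq {d : ℕ} {Ω : Set (Space d)} (μ₀ μ₁ : PosMeas Ω) : ℝ≥0∞ :=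
  ⨅ (ρ : ℝ → PosMeas Ω) (v : ℝ → Ω → Space d) (r : ℝ → Ω → ℝ) (_ : IsAdmissible μ₀ μ₁ ρ v r),
    action ρ v r

/-- The squared Fisher-Rao distance: the infimum of `∫₀¹ ∫_Ω |rₜ|² dρₜ dt` over all narrowly
continuous paths from `μ₀` to `μ₁` with `∂ₜρₜ = ρₜ rₜ`, i.e. over admissible paths with zero
velocity. -/
noncomputable def FRsq {d : ℕ} {Ω : Set (Space d)} (μ₀ μ₁ : PosMeas Ω) : ℝ≥0∞ :=
  ⨅ (ρ : ℝ → PosMeas Ω) (r : ℝ → Ω → ℝ) (_ : IsAdmissible μ₀ μ₁ ρ (fun _ _ => 0) r),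
    ∫⁻ t in Ioo (0 : ℝ) 1, ∫⁻ x : Ω, ‖r t x‖ₑ ^ 2 ∂(ρ t : Measure Ω)

/-- `x` is an element of `Argmin_{y ∈ S} J(y)`. -/
def IsArgmin {X : Type*} (J : X → EReal) (S : Set X) (x : X) : Prop :=
  x ∈ S ∧ ∀ y ∈ S, J x ≤ J y

/-- `ν` solves the Monge-Kantorovich step of time step `τ` from `μ ∈ M⁺₂`:
`ν ∈ Argmin { MK²(ρ, μ) / (2τ) + F(ρ) : ρ ∈ M⁺₂, |ρ| = |μ| }`. -/
def IsMKStep {d : ℕ} {Ω : Set (Space d)} (τ : ℝ) (F : PosMeas Ω → EReal) (μ ν : PosMeas Ω) : Prop :=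
  μ ∈ PosMeas2 Ω ∧
    IsArgmin (fun ρ => ((ENNReal.ofReal (1 / (2 * τ)) * MKsq ρ μ : ℝ≥0∞) : EReal) + F ρ)
      {ρ | ρ ∈ PosMeas2 Ω ∧ ρ.mass = μ.mass} ν

/-- `ν` solves the Fisher-Rao step of time step `τ` from `μ`:
`ν ∈ Argmin { FR²(ρ, μ) / (2τ) + F(ρ) : ρ ∈ M⁺ }`. -/
def IsFRStep {d : ℕ} {Ω : Set (Space d)} (τ : ℝ) (F : PosMeas Ω → EReal) (μ ν : PosMeas Ω) : Prop :=
  IsArgmin (fun ρ => ((ENNReal.ofReal (1 / (2 * τ)) * FRsq ρ μ : ℝ≥0∞) : EReal) + F ρ) univ ν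

/-- `ρ n` and `ρhalf n` (standing for `ρ^n` and `ρ^{n+1/2}`) are recursive solutions of the splitting
scheme: `ρ^n → ρ^{n+1/2}` is a Monge-Kantorovich step and `ρ^{n+1/2} → ρ^{n+1}` a Fisher-Rao step. -/
def IsSplittingScheme {d : ℕ} {Ω : Set (Space d)} (τ : ℝ) (F : PosMeas Ω → EReal)
    (ρ ρhalf : ℕ → PosMeas Ω) : Prop :=
  ∀ n, IsMKStep τ F (ρ n) (ρhalf n) ∧ IsFRStep τ F (ρhalf n) (ρ (n + 1))

end KFRSplitting

namespace KFRSplitting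

section

open Filter Topology Real ProbabilityTheory BoundedContinuousFunction
open scoped NNReal

/-! Each minimizer is compared with the point it starts from, where the squared distance vanishes.
This gives FR²/(2τ) + MK²/(2τ) + F(ρ^{n+1}) ≤ F(ρ^n) (`IsSplittingScheme.step_le`). Telescoping
yields the second bound; the sums are kept in additive form because `F` may be infinite along the
scheme.

The first bound follows from the second, at the price of another factor 2, through three
comparisons. KFR² ≤ FR² holds because a pure reaction path is a competitor. KFR² ≤ MK² holds because
any plan of finite cost can be transported along segments (`KFRsq_le_of_plan`); no optimal map is
needed, since the velocity at a space-time point is the average over the segments crossing there,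
and averaging does not increase the action. Finally KFR²(μ₀, μ₂) ≤ 2(KFR²(μ₀, μ₁) + KFR²(μ₁, μ₂)):
two paths are run at double speed and glued at time 1/2 (`IsAdmissible.exists_concat`).

Gluing is the delicate point: test functions of the glued path do not vanish at the junction. The
weak equation is therefore first extended to test functions with boundary values in time
(`IsAdmissible.integral_eq_sub`), after which the two terms at time 1/2 cancel. -/

/-! ### Time cutoffs and the fundamental theorem of calculus for weak derivatives -/

theorem deriv_smoothTransition_eq_zero {x : ℝ} (hx : x ∉ Icc (0 : ℝ) 1) :
    deriv smoothTransition x = 0 := by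
  rw [mem_Icc, not_and_or, not_le, not_le] at hx
  rcases hx with hx | hx
  · have : smoothTransition =ᶠ[𝓝 x] fun _ => 0 := by
      filter_upwards [Iio_mem_nhds hx] with y hy using smoothTransition.zero_of_nonpos (le_of_lt hy)
    simp [this.deriv_eq]
  · have : smoothTransition =ᶠ[𝓝 x] fun _ => 1 := by
      filter_upwards [Ioi_mem_nhds hx] with y hy using smoothTransition.one_of_one_le (le_of_lt hy)
    simp [this.deriv_eq]

theorem differentiable_smoothTransition : Differentiable ℝ smoothTransition :=
  (smoothTransition.contDiff (n := 1)).differentiable one_ne_zero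

theorem continuous_deriv_smoothTransition : Continuous (deriv smoothTransition) :=
  (smoothTransition.contDiff (n := 1)).continuous_deriv le_rfl

theorem integral_deriv_smoothTransition : ∫ x, deriv smoothTransition x = 1 := by
  have hint : Integrable (deriv smoothTransition) := by
    refine continuous_deriv_smoothTransition.integrable_of_hasCompactSupport ?_
    exact HasCompactSupport.intro isCompact_Icc fun x hx => deriv_smoothTransition_eq_zero hx
  have h0 : Tendsto smoothTransition atBot (𝓝 0) := by
    refine tendsto_const_nhds.congr' ?_
    filter_upwards [Iic_mem_atBot 0] with y hy using (smoothTransition.zero_of_nonpos hy).symm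
  have h1 : Tendsto smoothTransition atTop (𝓝 1) := by
    refine tendsto_const_nhds.congr' ?_
    filter_upwards [Ici_mem_atTop 1] with y hy using (smoothTransition.one_of_one_le hy).symm
  simpa using integral_of_hasDerivAt_of_tendsto
    (fun x => (differentiable_smoothTransition x).hasDerivAt) hint h0 h1

theorem tendsto_norm_mul_of_hasCompactSupport {f : ℝ → ℝ} (hf : HasCompactSupport f) :
    Tendsto (fun x => ‖x‖ ^ Module.finrank ℝ ℝ * f x) (Bornology.cobounded ℝ) (𝓝 0) := by
  refine tendsto_const_nhds.congr' ?_
  filter_upwards [(Bornology.isBounded_def.1 (IsCompact.isBounded hf))] with x hx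
  rw [image_eq_zero_of_notMem_tsupport hx, mul_zero]

/-- The smooth function equal to `1` on `[2/c, 1 - 2/c]` and to `0` outside `[1/c, 1 - 1/c]`. -/
noncomputable def plateau (c t : ℝ) : ℝ :=
  smoothTransition (c * t - 1) - smoothTransition (2 - c * (1 - t))

theorem contDiff_plateau (c : ℝ) : ContDiff ℝ ∞ (plateau c) := by
  unfold plateau
  exact (smoothTransition.contDiff.comp (by fun_prop)).sub
    (smoothTransition.contDiff.comp (by fun_prop))

theorem deriv_plateau (c t : ℝ) : deriv (plateau c) t =
    c * deriv smoothTransition (c * t - 1) - c * deriv smoothTransition (2 - c * (1 - t)) := by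
  have h1 : HasDerivAt (fun t : ℝ => c * t - 1) c t := by
    simpa using ((hasDerivAt_id t).const_mul c).sub_const 1
  have h2 : HasDerivAt (fun t : ℝ => 2 - c * (1 - t)) c t := by
    simpa using (((hasDerivAt_id t).const_sub 1).const_mul c).const_sub 2
  have := ((differentiable_smoothTransition _).hasDerivAt.comp t h1).sub
    ((differentiable_smoothTransition _).hasDerivAt.comp t h2)
  refine (this.deriv).trans ?_
  ring

/-- The bound 3 keeps the two transitions apart: if ct < 1 then 2 - c(1 - t) < 3 - c ≤ 0, and if c(1
- t) < 1 then ct - 1 > c - 2 ≥ 1. -/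
theorem support_plateau_subset {c : ℝ} (hc : 3 ≤ c) :
    Function.support (plateau c) ⊆ Icc (1 / c) (1 - 1 / c) := by
  have hc0 : 0 < c := by linarith
  intro t ht
  by_contra h
  apply ht
  rw [mem_Icc, not_and_or, not_le, not_le] at h
  unfold plateau
  rcases h with h | h
  · have h : c * t < 1 := by rwa [lt_div_iff₀' hc0] at h
    rw [smoothTransition.zero_of_nonpos (by linarith),
      smoothTransition.zero_of_nonpos (by linarith), sub_zero]
  · have h : c * (1 - t) < 1 := by
      rw [← lt_div_iff₀' hc0]; linarith
    rw [smoothTransition.one_of_one_le (by linarith),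
      smoothTransition.one_of_one_le (by linarith), sub_self]

theorem tsupport_plateau_subset {c : ℝ} (hc : 3 ≤ c) :
    tsupport (plateau c) ⊆ Icc (1 / c) (1 - 1 / c) :=
  closure_minimal (support_plateau_subset hc) isClosed_Icc

theorem tendsto_plateau {t : ℝ} (ht : t ∈ Ioo (0 : ℝ) 1) :
    Tendsto (fun c => plateau c t) atTop (𝓝 1) := by
  refine tendsto_const_nhds.congr' ?_
  have h0 : Tendsto (fun c : ℝ => c * t) atTop atTop := tendsto_id.atTop_mul_const ht.1
  have h1 : Tendsto (fun c : ℝ => c * (1 - t)) atTop atTop :=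
    tendsto_id.atTop_mul_const (by linarith [ht.2])
  filter_upwards [h0.eventually_ge_atTop 2, h1.eventually_ge_atTop 2] with c hc0 hc1
  unfold plateau
  rw [smoothTransition.one_of_one_le (by linarith),
      smoothTransition.zero_of_nonpos (by linarith), sub_zero]

theorem abs_plateau_le (c t : ℝ) : |plateau c t| ≤ 1 := by
  unfold plateau
  rw [abs_le]
  constructor <;> linarith [smoothTransition.nonneg (c * t - 1), smoothTransition.le_one (c * t - 1),
    smoothTransition.nonneg (2 - c * (1 - t)), smoothTransition.le_one (2 - c * (1 - t))]

/-- The derivative of `plateau c` is a difference of two rescaled mollifiers of mass one, which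
concentrate at 0 and at 1 as `c` grows. -/
theorem tendsto_integral_deriv_plateau_mul {G : ℝ → ℝ} (hG : Continuous G)
    (hGc : HasCompactSupport G) :
    Tendsto (fun c => ∫ t, deriv (plateau c) t * G t) atTop (𝓝 (G 0 - G 1)) := by
  have hGi : Integrable G := hG.integrable_of_hasCompactSupport hGc
  have hnn : ∀ x, 0 ≤ deriv smoothTransition x := fun x => smoothTransition.monotone.deriv_nonneg
  have hcs1 : HasCompactSupport fun x => deriv smoothTransition (x - 1) := by
    refine HasCompactSupport.intro (isCompact_Icc (a := 1) (b := 2)) fun x hx => ?_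
    refine deriv_smoothTransition_eq_zero fun h => hx ?_
    constructor <;> linarith [h.1, h.2]
  have hcs2 : HasCompactSupport fun x => deriv smoothTransition (2 - x) := by
    refine HasCompactSupport.intro (isCompact_Icc (a := 1) (b := 2)) fun x hx => ?_
    refine deriv_smoothTransition_eq_zero fun h => hx ?_
    constructor <;> linarith [h.1, h.2]
  have h0 := tendsto_integral_comp_smul_smul_of_integrable (μ := (volume : Measure ℝ))
    (φ := fun x => deriv smoothTransition (x - 1)) (fun x => hnn _)
    ((integral_sub_right_eq_self (deriv smoothTransition) 1).trans integral_deriv_smoothTransition)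
    (tendsto_norm_mul_of_hasCompactSupport hcs1) hGi hG.continuousAt
  have h1 := tendsto_integral_comp_smul_smul_of_integrable' (μ := (volume : Measure ℝ))
    (φ := fun x => deriv smoothTransition (2 - x)) (fun x => hnn _)
    ((integral_sub_left_eq_self (deriv smoothTransition) volume 2).trans
      integral_deriv_smoothTransition)
    (tendsto_norm_mul_of_hasCompactSupport hcs2) (x₀ := 1) hGi hG.continuousAt
  refine (h0.sub h1).congr fun c => ?_
  have hcont := continuous_deriv_smoothTransition
  simp only [Module.finrank_self, pow_one, smul_eq_mul]
  rw [← integral_sub]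
  · congr 1 with t
    rw [deriv_plateau]
    ring
  · exact Continuous.integrable_of_hasCompactSupport (by fun_prop) hGc.mul_left
  · exact Continuous.integrable_of_hasCompactSupport (by fun_prop) hGc.mul_left

/-- Take `plateau c` as test function and let `c` tend to infinity: the derivative term produces the
boundary values of `G`, the other one converges by domination. -/
theorem integral_eq_sub_of_weak_deriv {G h : ℝ → ℝ} (hG : ContinuousOn G (Icc 0 1))
    (hh : IntegrableOn h (Ioo 0 1))
    (hw : ∀ ψ : ℝ → ℝ, ContDiff ℝ ∞ ψ → tsupport ψ ⊆ Ioo 0 1 →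
      ∫ t in Ioo (0 : ℝ) 1, (deriv ψ t * G t + ψ t * h t) = 0) :
    ∫ t in Ioo (0 : ℝ) 1, h t = G 1 - G 0 := by
  -- The mollifier limit needs a function continuous and compactly supported on ℝ; extending by
  -- constants and multiplying by a bump leaves `G` unchanged on [0, 1].
  obtain ⟨b, hb1⟩ : ∃ b : ContDiffBump (1 / 2 : ℝ), ∀ t ∈ Icc (0 : ℝ) 1, b t = 1 := by
    refine ⟨⟨1, 2, by norm_num, by norm_num⟩, fun t ht => ContDiffBump.one_of_mem_closedBall _ ?_⟩
    rw [Real.closedBall_eq_Icc]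
    constructor <;> norm_num <;> linarith [ht.1, ht.2]
  set G' : ℝ → ℝ := fun t => b t * IccExtend zero_le_one ((Icc (0 : ℝ) 1).domRestrict G) t with hG'
  have hG'c : Continuous G' :=
    b.continuous.mul (continuousOn_iff_continuous_domRestrict.1 hG).Icc_extend'
  have hG'eq : ∀ t ∈ Icc (0 : ℝ) 1, G' t = G t := by
    intro t ht
    rw [hG']
    simp only [hb1 t ht, one_mul, IccExtend_of_mem _ _ ht]
    rfl
  have hlim1 : Tendsto (fun c => ∫ t in Ioo (0 : ℝ) 1, deriv (plateau c) t * G t) atTop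
      (𝓝 (G 0 - G 1)) := by
    have := tendsto_integral_deriv_plateau_mul hG'c b.hasCompactSupport.mul_right
    rw [hG'eq 0 (by simp), hG'eq 1 (by simp)] at this
    refine this.congr' ?_
    filter_upwards [eventually_ge_atTop 3] with c hc
    have hc0 : 0 < c := by linarith
    rw [← setIntegral_eq_integral_of_forall_compl_eq_zero (s := Ioo (0 : ℝ) 1)]
    · refine setIntegral_congr_fun measurableSet_Ioo fun t ht => ?_
      simp only [hG'eq t (Ioo_subset_Icc_self ht)]
    · intro t ht
      have : deriv (plateau c) t = 0 := by
        refine image_eq_zero_of_notMem_tsupport fun hmem => ht ?_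
        have := tsupport_plateau_subset hc (_root_.tsupport_deriv_subset hmem)
        have hpos : 0 < 1 / c := by positivity
        constructor <;> linarith [this.1, this.2]
      rw [this, zero_mul]
  have hlim2 : Tendsto (fun c => ∫ t in Ioo (0 : ℝ) 1, plateau c t * h t) atTop
      (𝓝 (∫ t in Ioo (0 : ℝ) 1, h t)) := by
    refine tendsto_integral_filter_of_dominated_convergence (fun t => ‖h t‖) ?_ ?_ hh.norm ?_
    · exact Eventually.of_forall fun c =>
        (contDiff_plateau c).continuous.aestronglyMeasurable.mul hh.aestronglyMeasurable
    · refine Eventually.of_forall fun c => Eventually.of_forall fun t => ?_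
      rw [norm_mul]
      exact mul_le_of_le_one_left (norm_nonneg _) (abs_plateau_le c t)
    · filter_upwards [ae_restrict_mem measurableSet_Ioo] with t ht
      simpa using (tendsto_plateau ht).mul_const (h t)
  have hsum := hlim1.add hlim2
  have hzero : ∀ᶠ c in atTop, (∫ t in Ioo (0 : ℝ) 1, deriv (plateau c) t * G t) +
      ∫ t in Ioo (0 : ℝ) 1, plateau c t * h t = 0 := by
    filter_upwards [eventually_ge_atTop 3] with c hc
    have hc0 : 0 < 1 / c := by positivity
    rw [← integral_add]
    · refine hw _ (contDiff_plateau c) ((tsupport_plateau_subset hc).trans fun t ht => ?_)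
      constructor <;> linarith [ht.1, ht.2]
    · refine IntegrableOn.mono_set (ContinuousOn.integrableOn_Icc ?_) Ioo_subset_Icc_self
      exact ((contDiff_plateau c).continuous_deriv (by simp)).continuousOn.mul hG
    · refine hh.norm.mono' ((contDiff_plateau c).continuous.aestronglyMeasurable.mul
        hh.aestronglyMeasurable) (Eventually.of_forall fun t => ?_)
      rw [norm_mul]
      exact mul_le_of_le_one_left (norm_nonneg _) (abs_plateau_le c t)
  have := tendsto_nhds_unique (hsum.congr' hzero) tendsto_const_nhds
  linarith

/-! ### The space-time measure of a narrowly continuous path -/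

/-- Closed sets form a generating π-system, and the measure of a closed set is a limit of integrals
of bounded continuous functions, each continuous in the parameter. -/
theorem measurable_toMeasure_of_continuous {T X : Type*} [TopologicalSpace T] [MeasurableSpace T]
    [BorelSpace T] [TopologicalSpace X] [HasOuterApproxClosed X] [MeasurableSpace X] [BorelSpace X]
    {ρ : T → FiniteMeasure X} (hρ : Continuous ρ) : Measurable fun t => (ρ t : Measure X) := by
  have hclosed : ∀ s : Set X, IsClosed s → Measurable fun t => (ρ t : Measure X) s := by
    intro s hs
    refine measurable_of_tendsto_metrizable
      (f := fun n t => ∫⁻ x, hs.apprSeq n x ∂(ρ t : Measure X)) (fun n => ?_) ?_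
    · have := (FiniteMeasure.continuous_testAgainstNN_eval (hs.apprSeq n)).comp hρ
      have h2 := (ENNReal.continuous_coe.comp this).measurable
      simpa [Function.comp_def] using h2
    · exact tendsto_pi_nhds.2 fun t => HasOuterApproxClosed.tendsto_lintegral_apprSeq hs _
  refine Measurable.measure_of_isPiSystem
    ((BorelSpace.measurable_eq).trans borel_eq_generateFrom_isClosed) isPiSystem_isClosed hclosed ?_
  exact hclosed univ isClosed_univ

variable {d : ℕ} {Ω : Set (Space d)}

theorem exists_mass_le {ρ : ℝ → PosMeas Ω} (hρ : ContinuousOn ρ (Icc 0 1)) :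
    ∃ C : ℝ≥0, ∀ t ∈ Icc (0 : ℝ) 1, (ρ t).mass ≤ C := by
  obtain ⟨C, hC⟩ := isCompact_Icc.bddAbove_image (FiniteMeasure.continuous_mass.comp_continuousOn hρ)
  exact ⟨C, fun t ht => hC ⟨t, ht, rfl⟩⟩

/-- The kernel `t ↦ ρ t` of a narrowly continuous path on `[0, 1]`, constant outside `[0, 1]`. -/
noncomputable def pathKernel (ρ : ℝ → PosMeas Ω) (hρ : ContinuousOn ρ (Icc 0 1)) : Kernel ℝ Ω where
  toFun t := (ρ (projIcc 0 1 zero_le_one t) : Measure Ω)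
  measurable' := measurable_toMeasure_of_continuous
    ((continuousOn_iff_continuous_domRestrict.1 hρ).Icc_extend' (h := zero_le_one))

theorem pathKernel_apply {ρ : ℝ → PosMeas Ω} (hρ : ContinuousOn ρ (Icc 0 1)) {t : ℝ}
    (ht : t ∈ Icc (0 : ℝ) 1) : pathKernel ρ hρ t = (ρ t : Measure Ω) := by
  change (ρ (projIcc 0 1 zero_le_one t) : Measure Ω) = _
  rw [projIcc_of_mem _ ht]

instance {ρ : ℝ → PosMeas Ω} (hρ : ContinuousOn ρ (Icc 0 1)) :
    IsFiniteKernel (pathKernel ρ hρ) := by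
  obtain ⟨C, hC⟩ := exists_mass_le hρ
  refine ⟨⟨C, ENNReal.coe_lt_top, fun t => ?_⟩⟩
  change (ρ (projIcc 0 1 zero_le_one t) : Measure Ω) univ ≤ C
  rw [← FiniteMeasure.ennreal_mass]
  exact_mod_cast hC _ (projIcc 0 1 zero_le_one t).2

/-- The measure `ρ_t dt` on `(0, 1) × Ω`. -/
noncomputable def pathMeasure (ρ : ℝ → PosMeas Ω) (hρ : ContinuousOn ρ (Icc 0 1)) :
    Measure (ℝ × Ω) :=
  (volume.restrict (Ioo (0 : ℝ) 1)) ⊗ₘ pathKernel ρ hρ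

instance {ρ : ℝ → PosMeas Ω} (hρ : ContinuousOn ρ (Icc 0 1)) :
    IsFiniteMeasure (pathMeasure ρ hρ) := by
  unfold pathMeasure; infer_instance

theorem lintegral_pathMeasure {ρ : ℝ → PosMeas Ω} (hρ : ContinuousOn ρ (Icc 0 1))
    {f : ℝ × Ω → ℝ≥0∞} (hf : Measurable f) :
    ∫⁻ p, f p ∂pathMeasure ρ hρ = ∫⁻ t in Ioo (0 : ℝ) 1, ∫⁻ x, f (t, x) ∂(ρ t : Measure Ω) := by
  rw [pathMeasure, Measure.lintegral_compProd hf]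
  refine setLIntegral_congr_fun measurableSet_Ioo fun t ht => ?_
  simp only [pathKernel_apply hρ (Ioo_subset_Icc_self ht)]

theorem integral_pathMeasure {ρ : ℝ → PosMeas Ω} (hρ : ContinuousOn ρ (Icc 0 1))
    {f : ℝ × Ω → ℝ} (hf : Integrable f (pathMeasure ρ hρ)) :
    ∫ p, f p ∂pathMeasure ρ hρ = ∫ t in Ioo (0 : ℝ) 1, ∫ x, f (t, x) ∂(ρ t : Measure Ω) := by
  rw [pathMeasure, Measure.integral_compProd hf]
  refine setIntegral_congr_fun measurableSet_Ioo fun t ht => ?_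
  simp only [pathKernel_apply hρ (Ioo_subset_Icc_self ht)]

theorem integrable_section_pathMeasure {ρ : ℝ → PosMeas Ω} (hρ : ContinuousOn ρ (Icc 0 1))
    {f : ℝ × Ω → ℝ} (hf : Integrable f (pathMeasure ρ hρ)) :
    ∀ᵐ t ∂volume.restrict (Ioo (0 : ℝ) 1), Integrable (fun x => f (t, x)) (ρ t : Measure Ω) := by
  have := ((Measure.integrable_compProd_iff hf.aestronglyMeasurable).1 hf).1
  filter_upwards [this, ae_restrict_mem measurableSet_Ioo] with t ht h
  rwa [pathKernel_apply hρ (Ioo_subset_Icc_self h)] at ht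

theorem integrableOn_integral_pathMeasure {ρ : ℝ → PosMeas Ω} (hρ : ContinuousOn ρ (Icc 0 1))
    {f : ℝ × Ω → ℝ} (hf : Integrable f (pathMeasure ρ hρ)) :
    IntegrableOn (fun t => ∫ x, f (t, x) ∂(ρ t : Measure Ω)) (Ioo 0 1) := by
  have h1 : Integrable (fun t => ∫ x, f (t, x) ∂(pathKernel ρ hρ t))
      (volume.restrict (Ioo (0 : ℝ) 1)) := by
    have := Integrable.integral_compProd (κ := Kernel.const Unit (volume.restrict (Ioo (0 : ℝ) 1)))
      (η := Kernel.prodMkLeft Unit (pathKernel ρ hρ)) (a := ()) (f := f) hf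
    simpa using this
  refine h1.congr ?_
  filter_upwards [ae_restrict_mem measurableSet_Ioo] with t h
  rw [pathKernel_apply hρ (Ioo_subset_Icc_self h)]

theorem action_eq_lintegral_pathMeasure {ρ : ℝ → PosMeas Ω} {v : ℝ → Ω → Space d} {r : ℝ → Ω → ℝ}
    (hρ : ContinuousOn ρ (Icc 0 1)) (hv : Measurable (Function.uncurry v))
    (hr : Measurable (Function.uncurry r)) :
    action ρ v r = ∫⁻ p, (‖v p.1 p.2‖ₑ ^ 2 + ‖r p.1 p.2‖ₑ ^ 2) ∂pathMeasure ρ hρ := by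
  rw [lintegral_pathMeasure hρ]
  · rfl
  · exact (hv.enorm.pow_const 2).add (hr.enorm.pow_const 2)

/-! ### The continuity equation tested up to the endpoints -/

/-- The finite measure is left arbitrary so as to cover both the space-time measure of a path and
the pushforward of a plan. -/
theorem integrable_weakIntegrand {M : Measure (ℝ × Ω)} [IsFiniteMeasure M]
    {v : ℝ → Ω → Space d} {r : ℝ → Ω → ℝ} (hv : Integrable (Function.uncurry v) M)
    (hr : Integrable (Function.uncurry r) M)
    {φ : ℝ × Space d → ℝ} (hφ : ContDiff ℝ ∞ φ) (hφc : HasCompactSupport φ) :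
    Integrable (fun p : ℝ × Ω => fderiv ℝ φ (p.1, (p.2 : Space d)) (1, 0)
      + fderiv ℝ φ (p.1, (p.2 : Space d)) (0, v p.1 p.2)
      + φ (p.1, (p.2 : Space d)) * r p.1 p.2) M := by
  have hcont : Continuous (fderiv ℝ φ) := hφ.continuous_fderiv (by simp)
  obtain ⟨C, hC⟩ := hcont.bounded_above_of_compact_support (hφc.fderiv (𝕜 := ℝ))
  obtain ⟨C', hC'⟩ := hφ.continuous.bounded_above_of_compact_support hφc
  have hemb : Continuous fun p : ℝ × Ω => (p.1, (p.2 : Space d)) := by fun_prop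
  have hd : Continuous fun p : ℝ × Ω => fderiv ℝ φ (p.1, (p.2 : Space d)) := hcont.comp hemb
  have hdapp : ∀ w : ℝ × Ω → ℝ × Space d, Integrable w M →
      Integrable (fun p : ℝ × Ω => fderiv ℝ φ (p.1, (p.2 : Space d)) (w p)) M := by
    intro w hw
    refine (hw.norm.const_mul C).mono' ?_ (Eventually.of_forall fun p => ?_)
    · exact (isBoundedBilinearMap_apply.continuous.comp_aestronglyMeasurable₂
        hd.aestronglyMeasurable hw.aestronglyMeasurable)
    · exact ((fderiv ℝ φ _).le_opNorm _).trans (by gcongr; exact hC _)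
  refine ((hdapp _ (integrable_const _)).add (hdapp _ ?_)).add ?_
  · exact (integrable_const (0 : ℝ)).prodMk hv
  · refine hr.bdd_mul (c := C') (hφ.continuous.comp hemb).aestronglyMeasurable
      (Eventually.of_forall fun p => hC' _)

theorem IsAdmissible.integrable_fields {μ₀ μ₁ : PosMeas Ω} {ρ : ℝ → PosMeas Ω}
    {v : ℝ → Ω → Space d} {r : ℝ → Ω → ℝ} (h : IsAdmissible μ₀ μ₁ ρ v r) :
    Integrable (Function.uncurry v) (pathMeasure ρ h.continuousOn) ∧
      Integrable (Function.uncurry r) (pathMeasure ρ h.continuousOn) := by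
  have hfin := h.action_lt_top
  rw [action_eq_lintegral_pathMeasure h.continuousOn h.measurable_velocity
    h.measurable_reaction] at hfin
  have key : ∀ {E : Type} [NormedAddCommGroup E] (f : ℝ × Ω → E)
      (_ : AEStronglyMeasurable f (pathMeasure ρ h.continuousOn))
      (_ : ∀ p, ‖f p‖ₑ ^ 2 ≤ ‖v p.1 p.2‖ₑ ^ 2 + ‖r p.1 p.2‖ₑ ^ 2),
      Integrable f (pathMeasure ρ h.continuousOn) := by
    intro E _ f hf hle
    refine MemLp.integrable (q := 2) (by norm_num) ⟨hf, ?_⟩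
    refine (eLpNorm_lt_top_iff_lintegral_rpow_enorm_lt_top two_ne_zero ENNReal.ofNat_ne_top).2 ?_
    refine lt_of_le_of_lt (lintegral_mono fun p => ?_) hfin
    simpa using hle p
  exact ⟨key _ h.measurable_velocity.aestronglyMeasurable fun p => le_self_add,
    key _ h.measurable_reaction.aestronglyMeasurable fun p => le_add_self⟩

/-- Both the test function and the measure move. The first variation is controlled by a Lipschitz
constant times a uniform mass bound, the second by narrow continuity. -/
theorem continuousOn_integral_test {ρ : ℝ → PosMeas Ω} (hρ : ContinuousOn ρ (Icc 0 1))
    {φ : ℝ × Space d → ℝ} (hφ : ContDiff ℝ ∞ φ) (hφc : HasCompactSupport φ) :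
    ContinuousOn (fun t => ∫ x : Ω, φ (t, (x : Space d)) ∂(ρ t : Measure Ω)) (Icc 0 1) := by
  obtain ⟨K, hK⟩ := hφ.lipschitzWith_of_hasCompactSupport hφc (by simp)
  obtain ⟨B, hB⟩ := hφ.continuous.bounded_above_of_compact_support hφc
  obtain ⟨C, hC⟩ := exists_mass_le hρ
  have hint : ∀ t s, Integrable (fun x : Ω => φ (t, (x : Space d))) (ρ s : Measure Ω) := by
    intro t s
    refine Integrable.of_bound (Continuous.aestronglyMeasurable ?_) B
      (Eventually.of_forall fun x => hB _)
    exact hφ.continuous.comp (by fun_prop)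
  intro s hs
  have h1 : Tendsto (fun t => ∫ x : Ω, φ (s, (x : Space d)) ∂(ρ t : Measure Ω)) (𝓝[Icc 0 1] s)
      (𝓝 (∫ x : Ω, φ (s, (x : Space d)) ∂(ρ s : Measure Ω))) := by
    have := FiniteMeasure.tendsto_iff_forall_integral_tendsto.1 (hρ s hs)
      (BoundedContinuousFunction.ofNormedAddCommGroup (fun x : Ω => φ (s, (x : Space d)))
        (hφ.continuous.comp (by fun_prop)) B fun x => hB _)
    simpa using this
  have h2 : Tendsto (fun t => ∫ x : Ω, (φ (t, (x : Space d)) - φ (s, (x : Space d)))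
      ∂(ρ t : Measure Ω)) (𝓝[Icc 0 1] s) (𝓝 0) := by
    have hb : Tendsto (fun t => K * |t - s| * C) (𝓝[Icc 0 1] s) (𝓝 0) := by
      have : Continuous fun t => (K : ℝ) * |t - s| * C := by fun_prop
      simpa using (this.tendsto s).mono_left nhdsWithin_le_nhds
    refine squeeze_zero_norm' ?_ hb
    filter_upwards [self_mem_nhdsWithin] with t ht
    refine (norm_integral_le_of_norm_le_const (C := K * |t - s|)
      (Eventually.of_forall fun x => ?_)).trans ?_
    · have := hK.dist_le_mul (t, (x : Space d)) (s, (x : Space d))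
      simpa [Prod.dist_eq, Real.dist_eq] using this
    · gcongr
      exact_mod_cast hC t ht
  have := h2.add h1
  rw [zero_add] at this
  refine this.congr fun t => ?_
  rw [integral_sub (hint _ _) (hint _ _)]
  ring

/-- Multiplying by a cutoff `ψ` in time makes `φ` an allowed test function, and the product rule
says that `t ↦ ∫ φ(t, ·) dρ t` has the inner integral as weak derivative. -/
theorem IsAdmissible.integral_eq_sub {μ₀ μ₁ : PosMeas Ω} {ρ : ℝ → PosMeas Ω}
    {v : ℝ → Ω → Space d} {r : ℝ → Ω → ℝ} (h : IsAdmissible μ₀ μ₁ ρ v r)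
    {φ : ℝ × Space d → ℝ} (hφ : ContDiff ℝ ∞ φ) (hφc : HasCompactSupport φ) :
    ∫ t in Ioo (0 : ℝ) 1, ∫ x : Ω,
      (fderiv ℝ φ (t, (x : Space d)) (1, 0) + fderiv ℝ φ (t, (x : Space d)) (0, v t x)
        + φ (t, (x : Space d)) * r t x) ∂(ρ t : Measure Ω) =
      ∫ x : Ω, φ (1, (x : Space d)) ∂(μ₁ : Measure Ω) -
        ∫ x : Ω, φ (0, (x : Space d)) ∂(μ₀ : Measure Ω) := by
  have hi := integrable_weakIntegrand h.integrable_fields.1 h.integrable_fields.2 hφ hφc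
  obtain ⟨B, hB⟩ := hφ.continuous.bounded_above_of_compact_support hφc
  rw [integral_eq_sub_of_weak_deriv (continuousOn_integral_test h.continuousOn hφ hφc)
    (integrableOn_integral_pathMeasure h.continuousOn hi), h.source, h.target]
  intro ψ hψ hψs
  have hψ' : ContDiff ℝ ∞ fun p : ℝ × Space d => ψ p.1 * φ p :=
    (hψ.comp contDiff_fst).mul hφ
  refine Eq.trans ?_ (h.solves (fun p => ψ p.1 * φ p) hψ' hφc.mul_left ?_)
  · refine setIntegral_congr_ae measurableSet_Ioo ?_
    have hsec := (ae_restrict_iff' measurableSet_Ioo).1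
      (integrable_section_pathMeasure h.continuousOn hi)
    filter_upwards [hsec] with t ht hmem
    rw [← integral_const_mul, ← integral_const_mul, ← integral_add]
    · refine integral_congr_ae (Eventually.of_forall fun x => ?_)
      have hψd : HasFDerivAt (fun p : ℝ × Space d => ψ p.1)
          (deriv ψ t • ContinuousLinearMap.fst ℝ ℝ (Space d)) (t, (x : Space d)) := by
        have := (hψ.differentiable (by simp) t).hasDerivAt
        exact HasDerivAt.comp_hasFDerivAt (t, (x : Space d)) this hasFDerivAt_fst
      have hφd := (hφ.differentiable (by simp) (t, (x : Space d))).hasFDerivAt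
      have hmul : fderiv ℝ (fun p : ℝ × Space d => ψ p.1 * φ p) (t, (x : Space d)) = _ :=
        (hψd.mul hφd).fderiv
      beta_reduce
      rw [hmul]
      simp
      ring
    · refine (Integrable.of_bound (Continuous.aestronglyMeasurable ?_) B
        (Eventually.of_forall fun x => hB _)).const_mul _
      exact hφ.continuous.comp (by fun_prop)
    · exact (ht hmem).const_mul _
  · have hsub : tsupport (fun p : ℝ × Space d => ψ p.1 * φ p) ⊆ Prod.fst ⁻¹' tsupport ψ := by
      refine closure_minimal (fun p hp => ?_) ((isClosed_tsupport ψ).preimage continuous_fst)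
      exact subset_tsupport _ (left_ne_zero_of_mul hp)
    exact fun p hp => ⟨hψs (hsub hp), mem_univ _⟩

/-! ### Concatenation of paths and the relaxed triangle inequality -/

/-- The affine change of time `s ↦ (s + b) / 2`. -/
noncomputable def addDivTwo (b : ℝ) : ℝ ≃ₜ ℝ where
  toFun s := (s + b) / 2
  invFun t := 2 * t - b
  left_inv s := by ring
  right_inv t := by ring

theorem measurableEmbedding_add_div_two (b : ℝ) : MeasurableEmbedding fun s : ℝ => (s + b) / 2 :=
  (addDivTwo b).measurableEmbedding

theorem map_restrict_add_div_two (b : ℝ) :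
    (volume.restrict (Ioo (0 : ℝ) 1)).map (fun s => (s + b) / 2) =
      (2 : ℝ≥0∞) • volume.restrict (Ioo (b / 2) ((b + 1) / 2)) := by
  have hmap : (volume : Measure ℝ).map (fun s => (s + b) / 2) = (2 : ℝ≥0∞) • volume := by
    have h1 : (fun s : ℝ => (s + b) / 2) = (fun s => s * 2⁻¹) ∘ fun s => s + b := by
      ext s; simp [div_eq_mul_inv]
    rw [h1, ← Measure.map_map (by fun_prop) (by fun_prop), map_add_right_eq_self,
      Real.map_volume_mul_right (by norm_num)]
    simp
  have hpre : (fun s : ℝ => (s + b) / 2) ⁻¹' Ioo (b / 2) ((b + 1) / 2) = Ioo 0 1 := by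
    ext s
    simp only [mem_preimage, mem_Ioo]
    constructor <;> intro h <;> constructor <;> linarith [h.1, h.2]
  rw [← hpre, ← (measurableEmbedding_add_div_two b).restrict_map, hmap, Measure.restrict_smul]

/-- The point 1/2 is negligible. Writing each half as an image of (0, 1) reduces integrals along a
glued path to integrals along its pieces. -/
theorem restrict_Ioo_eq_halves :
    volume.restrict (Ioo (0 : ℝ) 1) = (2⁻¹ : ℝ≥0∞) •
      ((volume.restrict (Ioo (0 : ℝ) 1)).map (fun s => (s + 0) / 2) +
        (volume.restrict (Ioo (0 : ℝ) 1)).map (fun s => (s + 1) / 2)) := by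
  rw [map_restrict_add_div_two, map_restrict_add_div_two, ← smul_add, smul_smul,
    ENNReal.inv_mul_cancel two_ne_zero ENNReal.ofNat_ne_top, one_smul,
    ← Measure.restrict_union _ measurableSet_Ioo]
  · refine Measure.restrict_congr_set ?_
    norm_num
    have : Ioo (0 : ℝ) 1 \ {1 / 2} = Ioo 0 (1 / 2) ∪ Ioo (1 / 2) 1 := by
      ext t
      simp only [Set.mem_sdiff, mem_Ioo, mem_singleton_iff, mem_union]
      constructor
      · rintro ⟨⟨h0, h1⟩, h2⟩
        rcases lt_or_gt_of_ne h2 with h | h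
        · exact Or.inl ⟨h0, h⟩
        · exact Or.inr ⟨h, h1⟩
      · rintro (h | h)
        · exact ⟨⟨h.1, by linarith [h.2]⟩, h.2.ne⟩
        · exact ⟨⟨by linarith [h.1], h.2⟩, h.1.ne'⟩
    rw [← this]
    exact (sdiff_null_ae_eq_self (by simp)).symm
  · rw [Set.disjoint_left]
    intro t h1 h2
    norm_num at h1 h2
    linarith [h1.2, h2.1]

/-- The density in time of the weak formulation of the continuity equation tested with `φ`. -/
noncomputable def weakDensity (φ : ℝ × Space d → ℝ) (ρ : ℝ → PosMeas Ω)
    (v : ℝ → Ω → Space d) (r : ℝ → Ω → ℝ) (t : ℝ) : ℝ :=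
  ∫ x : Ω, (fderiv ℝ φ (t, (x : Space d)) (1, 0) + fderiv ℝ φ (t, (x : Space d)) (0, v t x)
        + φ (t, (x : Space d)) * r t x) ∂(ρ t : Measure Ω)

/-- The affine change of time `(s, x) ↦ ((s + b) / 2, x)`. -/
noncomputable def halfTime (d : ℕ) (b : ℝ) : ℝ × Space d ≃ₜ ℝ × Space d :=
  (addDivTwo b).prodCongr (Homeomorph.refl _)

theorem halfTime_apply (b : ℝ) (p : ℝ × Space d) : halfTime d b p = ((p.1 + b) / 2, p.2) := rfl

theorem contDiff_comp_halfTime {φ : ℝ × Space d → ℝ} (hφ : ContDiff ℝ ∞ φ) (b : ℝ) :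
    ContDiff ℝ ∞ (φ ∘ halfTime d b) := by
  refine hφ.comp ?_
  change ContDiff ℝ ∞ fun p : ℝ × Space d => ((p.1 + b) / 2, p.2)
  fun_prop

theorem fderiv_comp_halfTime {φ : ℝ × Space d → ℝ} (hφ : ContDiff ℝ ∞ φ) (b : ℝ)
    (p w : ℝ × Space d) :
    fderiv ℝ (φ ∘ halfTime d b) p w = fderiv ℝ φ ((p.1 + b) / 2, p.2) (w.1 / 2, w.2) := by
  have h1 : HasFDerivAt (halfTime d b)
      (((2 : ℝ)⁻¹ • ContinuousLinearMap.fst ℝ ℝ (Space d)).prod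
        (ContinuousLinearMap.snd ℝ ℝ (Space d))) p := by
    have : HasFDerivAt (fun p : ℝ × Space d => (p.1 + b) / 2)
        ((2 : ℝ)⁻¹ • ContinuousLinearMap.fst ℝ ℝ (Space d)) p := by
      simpa [div_eq_mul_inv] using
        ((hasFDerivAt_fst (𝕜 := ℝ) (p := p)).add_const b).mul_const (2 : ℝ)⁻¹
    exact this.prodMk hasFDerivAt_snd
  have h2 := (hφ.differentiable (by simp) (halfTime d b p)).hasFDerivAt
  rw [(h2.comp p h1).fderiv]
  simp [halfTime_apply, div_eq_inv_mul]

/-- The chain rule halves the time derivative of the test function while the fields are doubled, so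
a common factor 2 comes out. -/
theorem weakDensity_halfTime {φ : ℝ × Space d → ℝ} (hφ : ContDiff ℝ ∞ φ) {b s : ℝ}
    {ρ σ : ℝ → PosMeas Ω} {v w : ℝ → Ω → Space d} {r u : ℝ → Ω → ℝ}
    (hσ : σ ((s + b) / 2) = ρ s) (hw : ∀ x, w ((s + b) / 2) x = (2 : ℝ) • v s x)
    (hu : ∀ x, u ((s + b) / 2) x = 2 * r s x) :
    weakDensity φ σ w u ((s + b) / 2) = 2 * weakDensity (φ ∘ halfTime d b) ρ v r s := by
  rw [weakDensity, weakDensity, hσ, ← integral_const_mul]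
  refine integral_congr_ae (Eventually.of_forall fun x => ?_)
  beta_reduce
  rw [fderiv_comp_halfTime hφ, fderiv_comp_halfTime hφ, hw, hu, mul_add, mul_add,
    ← smul_eq_mul 2 (fderiv ℝ φ _ _), ← smul_eq_mul 2 (fderiv ℝ φ _ _), ← map_smul, ← map_smul]
  simp [halfTime_apply]
  ring

theorem IsAdmissible.weakDensity_half {μ₀ μ₁ : PosMeas Ω} {ρ σ : ℝ → PosMeas Ω}
    {v w : ℝ → Ω → Space d} {r u : ℝ → Ω → ℝ} (h : IsAdmissible μ₀ μ₁ ρ v r)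
    {φ : ℝ × Space d → ℝ} (hφ : ContDiff ℝ ∞ φ) (hφc : HasCompactSupport φ) (b : ℝ)
    (hσ : ∀ s ∈ Ioo (0 : ℝ) 1, σ ((s + b) / 2) = ρ s)
    (hw : ∀ s ∈ Ioo (0 : ℝ) 1, ∀ x, w ((s + b) / 2) x = (2 : ℝ) • v s x)
    (hu : ∀ s ∈ Ioo (0 : ℝ) 1, ∀ x, u ((s + b) / 2) x = 2 * r s x) :
    Integrable (weakDensity φ σ w u)
        ((volume.restrict (Ioo (0 : ℝ) 1)).map (fun s => (s + b) / 2)) ∧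
      ∫ t, weakDensity φ σ w u t ∂(volume.restrict (Ioo (0 : ℝ) 1)).map (fun s => (s + b) / 2) =
        2 * (∫ x : Ω, φ ((1 + b) / 2, (x : Space d)) ∂(μ₁ : Measure Ω) -
          ∫ x : Ω, φ ((0 + b) / 2, (x : Space d)) ∂(μ₀ : Measure Ω)) := by
  have hφ' := contDiff_comp_halfTime hφ b
  have hφc' : HasCompactSupport (φ ∘ halfTime d b) := hφc.comp_homeomorph _
  have hi := integrableOn_integral_pathMeasure h.continuousOn
    (integrable_weakIntegrand h.integrable_fields.1 h.integrable_fields.2 hφ' hφc')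
  have heq : ∀ s ∈ Ioo (0 : ℝ) 1, weakDensity φ σ w u ((s + b) / 2) =
      2 * weakDensity (φ ∘ halfTime d b) ρ v r s := fun s hs =>
    weakDensity_halfTime hφ (hσ s hs) (hw s hs) (hu s hs)
  have hemb := measurableEmbedding_add_div_two b
  rw [hemb.integrable_map_iff, hemb.integral_map]
  constructor
  · refine (hi.const_mul 2).congr ?_
    filter_upwards [ae_restrict_mem measurableSet_Ioo] with s hs using (heq s hs).symm
  · rw [setIntegral_congr_fun measurableSet_Ioo heq, integral_const_mul]
    congr 1
    exact h.integral_eq_sub hφ' hφc'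

theorem lintegral_action_half {ρ σ : ℝ → PosMeas Ω}
    {v w : ℝ → Ω → Space d} {r u : ℝ → Ω → ℝ} (b : ℝ)
    (hσ : ∀ s ∈ Ioo (0 : ℝ) 1, σ ((s + b) / 2) = ρ s)
    (hw : ∀ s ∈ Ioo (0 : ℝ) 1, ∀ x, w ((s + b) / 2) x = (2 : ℝ) • v s x)
    (hu : ∀ s ∈ Ioo (0 : ℝ) 1, ∀ x, u ((s + b) / 2) x = 2 * r s x) :
    ∫⁻ t, ∫⁻ x : Ω, (‖w t x‖ₑ ^ 2 + ‖u t x‖ₑ ^ 2) ∂(σ t : Measure Ω)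
      ∂(volume.restrict (Ioo (0 : ℝ) 1)).map (fun s => (s + b) / 2) = 4 * action ρ v r := by
  rw [(measurableEmbedding_add_div_two b).lintegral_map, action,
    ← lintegral_const_mul' _ _ ENNReal.ofNat_ne_top]
  refine setLIntegral_congr_fun measurableSet_Ioo fun s hs => ?_
  beta_reduce
  rw [hσ s hs, ← lintegral_const_mul' _ _ ENNReal.ofNat_ne_top]
  refine lintegral_congr fun x => ?_
  rw [hw s hs, hu s hs, enorm_smul, enorm_mul, mul_pow, mul_pow, mul_add]
  have : ‖(2 : ℝ)‖ₑ ^ 2 = 4 := by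
    rw [Real.enorm_eq_ofReal zero_le_two, ENNReal.ofReal_ofNat]
    norm_num
  rw [this]

/-- The concatenation at time `1/2` of two paths of measures or of fields. -/
noncomputable def concat {X : Type*} (f g : ℝ → X) (t : ℝ) : X :=
  if t ≤ 1 / 2 then f (2 * t) else g (2 * t - 1)

theorem concat_left {X : Type*} (f g : ℝ → X) {s : ℝ} (hs : s ∈ Ioo (0 : ℝ) 1) :
    concat f g ((s + 0) / 2) = f s := by
  rw [concat, if_pos (by linarith [hs.2])]
  congr 1
  ring

theorem concat_right {X : Type*} (f g : ℝ → X) {s : ℝ} (hs : s ∈ Ioo (0 : ℝ) 1) :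
    concat f g ((s + 1) / 2) = g s := by
  rw [concat, if_neg (by linarith [hs.1])]
  congr 1
  ring

theorem continuousOn_concat {X : Type*} [TopologicalSpace X] {f g : ℝ → X}
    (hf : ContinuousOn f (Icc 0 1)) (hg : ContinuousOn g (Icc 0 1)) (hfg : f 1 = g 0) :
    ContinuousOn (concat f g) (Icc 0 1) := by
  have h1 : ContinuousOn (concat f g) (Icc 0 (1 / 2)) := by
    refine (hf.comp (f := fun t : ℝ => 2 * t) (by fun_prop) fun t ht => ?_).congr fun t ht => ?_
    · constructor <;> linarith [ht.1, ht.2]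
    · exact if_pos ht.2
  have h2 : ContinuousOn (concat f g) (Icc (1 / 2) 1) := by
    refine (hg.comp (f := fun t : ℝ => 2 * t - 1) (by fun_prop) fun t ht => ?_).congr
      fun t ht => ?_
    · constructor <;> linarith [ht.1, ht.2]
    · rcases eq_or_lt_of_le ht.1 with h | h
      · rw [concat, if_pos h.ge, ← h]
        norm_num [hfg]
      · exact if_neg (not_le.2 h)
  rw [← Icc_union_Icc_eq_Icc (show (0 : ℝ) ≤ 1 / 2 by norm_num) (by norm_num)]
  exact h1.union_of_isClosed h2 isClosed_Icc isClosed_Icc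

theorem measurable_concat {E : Type*} [MeasurableSpace E] {f g : ℝ → Ω → E}
    (hf : Measurable (Function.uncurry f)) (hg : Measurable (Function.uncurry g)) :
    Measurable (Function.uncurry (concat f g)) := by
  have : Function.uncurry (concat f g) = fun p => if p.1 ≤ 1 / 2 then
      Function.uncurry f (2 * p.1, p.2) else Function.uncurry g (2 * p.1 - 1, p.2) := by
    ext p
    simp only [Function.uncurry, concat]
    split_ifs <;> rfl
  rw [this]
  exact Measurable.ite (measurableSet_le measurable_fst measurable_const)
    (hf.comp (by fun_prop)) (hg.comp (by fun_prop))

theorem IsAdmissible.exists_concat {μ₀ μ₁ μ₂ : PosMeas Ω} {ρ ρ' : ℝ → PosMeas Ω}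
    {v v' : ℝ → Ω → Space d} {r r' : ℝ → Ω → ℝ} (h : IsAdmissible μ₀ μ₁ ρ v r)
    (h' : IsAdmissible μ₁ μ₂ ρ' v' r') :
    ∃ σ w u, IsAdmissible μ₀ μ₂ σ w u ∧ action σ w u = 2 * (action ρ v r + action ρ' v' r') := by
  set σ := concat ρ ρ' with hσ
  set w := concat (fun t x => (2 : ℝ) • v t x) (fun t x => (2 : ℝ) • v' t x) with hw
  set u := concat (fun t x => 2 * r t x) (fun t x => 2 * r' t x) with hu
  have hσ0 : ∀ s ∈ Ioo (0 : ℝ) 1, σ ((s + 0) / 2) = ρ s := fun s hs => concat_left _ _ hs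
  have hσ1 : ∀ s ∈ Ioo (0 : ℝ) 1, σ ((s + 1) / 2) = ρ' s := fun s hs => concat_right _ _ hs
  have hw0 : ∀ s ∈ Ioo (0 : ℝ) 1, ∀ x, w ((s + 0) / 2) x = (2 : ℝ) • v s x := fun s hs x => by
    rw [hw, concat_left _ _ hs]
  have hw1 : ∀ s ∈ Ioo (0 : ℝ) 1, ∀ x, w ((s + 1) / 2) x = (2 : ℝ) • v' s x := fun s hs x => by
    rw [hw, concat_right _ _ hs]
  have hu0 : ∀ s ∈ Ioo (0 : ℝ) 1, ∀ x, u ((s + 0) / 2) x = 2 * r s x := fun s hs x => by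
    rw [hu, concat_left _ _ hs]
  have hu1 : ∀ s ∈ Ioo (0 : ℝ) 1, ∀ x, u ((s + 1) / 2) x = 2 * r' s x := fun s hs x => by
    rw [hu, concat_right _ _ hs]
  have hact : action σ w u = 2 * (action ρ v r + action ρ' v' r') := by
    rw [action, restrict_Ioo_eq_halves, lintegral_smul_measure, lintegral_add_measure,
      lintegral_action_half 0 hσ0 hw0 hu0, lintegral_action_half 1 hσ1 hw1 hu1, ← mul_add,
      smul_eq_mul, ← mul_assoc]
    congr 1
    rw [show (4 : ℝ≥0∞) = 2 * 2 by norm_num, ← mul_assoc,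
      ENNReal.inv_mul_cancel two_ne_zero ENNReal.ofNat_ne_top, one_mul]
  refine ⟨σ, w, u, ⟨?_, ?_, ?_, ?_, ?_, ?_, ?_⟩, hact⟩
  · exact continuousOn_concat h.continuousOn h'.continuousOn (h.target.trans h'.source.symm)
  · rw [hσ, concat, if_pos (by norm_num), mul_zero, h.source]
  · rw [hσ, concat, if_neg (by norm_num), ← h'.target]
    norm_num
  · exact measurable_concat (h.measurable_velocity.const_smul (2 : ℝ))
      (h'.measurable_velocity.const_smul (2 : ℝ))
  · exact measurable_concat (h.measurable_reaction.const_mul (2 : ℝ))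
      (h'.measurable_reaction.const_mul (2 : ℝ))
  · rw [hact]
    exact ENNReal.mul_lt_top ENNReal.ofNat_lt_top
      (ENNReal.add_lt_top.2 ⟨h.action_lt_top, h'.action_lt_top⟩)
  · intro φ hφ hφc hsupp
    have hvanish : ∀ t, t ∉ Ioo (0 : ℝ) 1 → ∀ x, φ (t, x) = 0 := fun t ht x =>
      image_eq_zero_of_notMem_tsupport fun hmem => ht (hsupp hmem).1
    obtain ⟨hi0, he0⟩ := h.weakDensity_half hφ hφc 0 hσ0 hw0 hu0
    obtain ⟨hi1, he1⟩ := h'.weakDensity_half hφ hφc 1 hσ1 hw1 hu1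
    change ∫ t in Ioo (0 : ℝ) 1, weakDensity φ σ w u t = 0
    -- The integrals of `φ` at time 1/2 against `μ₁` cancel; those at times 0 and 1 vanish by the
    -- support condition.
    rw [restrict_Ioo_eq_halves, integral_smul_measure, integral_add_measure hi0 hi1, he0, he1]
    norm_num
    simp [hvanish 0 (by simp), hvanish 1 (by simp)]

/-- Double speed multiplies the action density by 4 and each piece lasts half the time, whence the
constant 2. -/
theorem KFRsq_le_two_mul_add (μ₀ μ₁ μ₂ : PosMeas Ω) :
    KFRsq μ₀ μ₂ ≤ 2 * (KFRsq μ₀ μ₁ + KFRsq μ₁ μ₂) := by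
  have key : ∀ ρ v r, IsAdmissible μ₀ μ₁ ρ v r → ∀ ρ' v' r', IsAdmissible μ₁ μ₂ ρ' v' r' →
      KFRsq μ₀ μ₂ ≤ 2 * (action ρ v r + action ρ' v' r') := by
    intro ρ v r h ρ' v' r' h'
    obtain ⟨σ, w, u, hadm, hact⟩ := h.exists_concat h'
    exact hact ▸ (iInf₂_le σ w).trans (iInf₂_le u hadm)
  conv_rhs => rw [KFRsq, KFRsq]
  simp only [ENNReal.iInf_add, ENNReal.add_iInf, ENNReal.mul_iInf_of_ne two_ne_zero
    ENNReal.ofNat_ne_top, le_iInf_iff]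
  exact fun ρ v r h ρ' v' r' h' => key _ _ _ (by assumption) _ _ _ (by assumption)

/-! ### Transport along segments and the bound of KFR by MK -/

/-- The integrand is the derivative of `t ↦ φ(t, x + t w)`, which vanishes at both ends. The case `w
= 0` serves paths at rest. -/
theorem integral_fderiv_line_eq_zero {φ : ℝ × Space d → ℝ} (hφ : ContDiff ℝ ∞ φ)
    (hsupp : tsupport φ ⊆ Ioo (0 : ℝ) 1 ×ˢ (univ : Set (Space d))) (x w : Space d) :
    ∫ t in Ioo (0 : ℝ) 1, fderiv ℝ φ (t, x + t • w) (1, w) = 0 := by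
  have hvanish : ∀ t, t ∉ Ioo (0 : ℝ) 1 → ∀ x, φ (t, x) = 0 := fun t ht x =>
    image_eq_zero_of_notMem_tsupport fun hmem => ht (hsupp hmem).1
  have hline : ∀ t : ℝ, HasDerivAt (fun t : ℝ => (t, x + t • w)) (1, w) t := fun t => by
    simpa using (hasDerivAt_id t).prodMk (((hasDerivAt_id t).smul_const w).const_add x)
  have hderiv : ∀ t : ℝ, HasDerivAt (fun t : ℝ => φ (t, x + t • w))
      (fderiv ℝ φ (t, x + t • w) (1, w)) t := fun t =>
    (hφ.differentiable (by simp) (t, x + t • w)).hasFDerivAt.comp_hasDerivAt t (hline t)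
  have hcont : Continuous fun t : ℝ => fderiv ℝ φ (t, x + t • w) (1, w) :=
    ((hφ.continuous_fderiv (by simp)).comp (by fun_prop)).clm_apply continuous_const
  rw [← integral_Ioc_eq_integral_Ioo, ← intervalIntegral.integral_of_le zero_le_one,
    intervalIntegral.integral_eq_sub_of_hasDerivAt (fun t _ => hderiv t)
      (hcont.intervalIntegrable _ _), hvanish 1 (by simp), hvanish 0 (by simp), sub_zero]

theorem FRsq_self (μ : PosMeas Ω) : FRsq μ μ = 0 := by
  have hadm : IsAdmissible μ μ (fun _ => μ) (fun _ _ => 0) (fun _ _ => 0) := by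
    refine ⟨continuousOn_const, rfl, rfl, measurable_const, measurable_const, ?_, ?_⟩
    · simp [action]
    · intro φ hφ hφc hsupp
      have hcont : Continuous (fderiv ℝ φ) := hφ.continuous_fderiv (by simp)
      obtain ⟨C, hC⟩ := hcont.bounded_above_of_compact_support (hφc.fderiv (𝕜 := ℝ))
      have hzero : ∀ L : ℝ × Space d →L[ℝ] ℝ, L (0, 0) = 0 := fun L => map_zero L
      simp only [hzero, mul_zero, add_zero]
      rw [integral_integral_swap]
      · refine integral_eq_zero_of_ae (Eventually.of_forall fun x => ?_)
        simpa using integral_fderiv_line_eq_zero hφ hsupp (x : Space d) 0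
      · refine Integrable.of_bound (Continuous.aestronglyMeasurable ?_)
          (C * ‖((1, 0) : ℝ × Space d)‖) (Eventually.of_forall fun p => ?_)
        · have h1 : Continuous fun p : ℝ × Ω => fderiv ℝ φ (p.1, (p.2 : Space d)) :=
            hcont.comp (by fun_prop)
          exact h1.clm_apply continuous_const
        · exact ((fderiv ℝ φ _).le_opNorm _).trans (by gcongr; exact hC _)
  refine le_antisymm ((iInf₂_le _ _).trans ((iInf_le _ hadm).trans ?_)) bot_le
  simp

/-- The point at time `t`, clamped to `[0, 1]`, on the segment between two points of `Ω`. -/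
noncomputable def interp (hΩ : Convex ℝ Ω) (t : ℝ) (p : Ω × Ω) : Ω :=
  ⟨(p.1 : Space d) + (projIcc (0 : ℝ) 1 zero_le_one t : ℝ) • ((p.2 : Space d) - p.1),
    hΩ.add_smul_sub_mem p.1.2 p.2.2 (projIcc (0 : ℝ) 1 zero_le_one t).2⟩

theorem continuous_interp (hΩ : Convex ℝ Ω) :
    Continuous fun q : ℝ × (Ω × Ω) => interp hΩ q.1 q.2 := by
  unfold interp
  have : Continuous fun t : ℝ => (projIcc (0 : ℝ) 1 zero_le_one t : ℝ) :=
    continuous_subtype_val.comp continuous_projIcc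
  refine Continuous.subtype_mk ?_ _
  exact (by fun_prop : Continuous fun q : ℝ × (Ω × Ω) => (q.2.1 : Space d)).add
    ((this.comp continuous_fst).smul (by fun_prop))

theorem coe_interp (hΩ : Convex ℝ Ω) {t : ℝ} (ht : t ∈ Icc (0 : ℝ) 1) (p : Ω × Ω) :
    (interp hΩ t p : Space d) = p.1 + t • ((p.2 : Space d) - p.1) := by
  simp only [interp, projIcc_of_mem _ ht]

/-- The displacement interpolation of a transference plan. -/
noncomputable def displacement (hΩ : Convex ℝ Ω) (γ : FiniteMeasure (Ω × Ω)) (t : ℝ) : PosMeas Ω :=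
  γ.map (interp hΩ t)

theorem toMeasure_displacement (hΩ : Convex ℝ Ω) (γ : FiniteMeasure (Ω × Ω)) (t : ℝ) :
    (displacement hΩ γ t : Measure Ω) = (γ : Measure (Ω × Ω)).map (interp hΩ t) := rfl

theorem continuous_displacement (hΩ : Convex ℝ Ω) (γ : FiniteMeasure (Ω × Ω)) :
    Continuous (displacement hΩ γ) := by
  refine continuous_iff_continuousAt.2 fun s => ?_
  refine FiniteMeasure.tendsto_iff_forall_integral_tendsto.2 fun f => ?_
  have hf : ∀ t, ∫ x, f x ∂(displacement hΩ γ t : Measure Ω) =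
      ∫ p, f (interp hΩ t p) ∂(γ : Measure (Ω × Ω)) := fun t => by
    rw [toMeasure_displacement, integral_map]
    · exact ((continuous_interp hΩ).comp (by fun_prop : Continuous fun p => (t, p))).aemeasurable
    · exact f.continuous.aestronglyMeasurable
  simp only [hf]
  refine Continuous.tendsto (continuous_of_dominated (bound := fun _ => ‖f‖) (fun t => ?_)
    (fun t => Eventually.of_forall fun p => f.norm_coe_le_norm _) (integrable_const _)
    (Eventually.of_forall fun p => ?_)) s
  · exact (f.continuous.comp
      ((continuous_interp hΩ).comp (by fun_prop : Continuous fun p => (t, p)))).aestronglyMeasurable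
  · exact f.continuous.comp
      ((continuous_interp hΩ).comp (by fun_prop : Continuous fun t => (t, p)))

theorem lintegral_enorm_sq_eq {α E : Type*} [MeasurableSpace α] [NormedAddCommGroup E]
    (μ : Measure α) (f : α → E) : ∫⁻ x, ‖f x‖ₑ ^ 2 ∂μ = eLpNorm f 2 μ ^ 2 := by
  have := eLpNorm_nnreal_pow_eq_lintegral (μ := μ) (f := f) (p := 2) two_ne_zero
  norm_num at this
  exact_mod_cast this.symm

/-- Pushing forward a square integrable vector field `f` along a measure preserving map `T`: there is
a square integrable field `v` with no larger norm and the same pairing with the fields `w ∘ T`. -/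
theorem exists_pushforward_field {α β E : Type*} [MeasurableSpace α] [MeasurableSpace β]
    [NormedAddCommGroup E] [InnerProductSpace ℝ E] [CompleteSpace E] [MeasurableSpace E]
    [BorelSpace E] {μ : Measure α} {ν : Measure β} {T : α → β} (hT : MeasurePreserving T μ ν)
    {f : α → E} (hf : MemLp f 2 μ) :
    ∃ v : β → E, Measurable v ∧ MemLp v 2 ν ∧ ∫⁻ y, ‖v y‖ₑ ^ 2 ∂ν ≤ ∫⁻ x, ‖f x‖ₑ ^ 2 ∂μ ∧
      ∀ w : β → E, MemLp w 2 ν → ∫ y, inner ℝ (w y) (v y) ∂ν = ∫ x, inner ℝ (w (T x)) (f x) ∂μ := by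
  -- `J` is the L² isometry `w ↦ w ∘ T`. Its adjoint, of norm at most one, averages `f` over the
  -- fibres of `T`; the pairing identity is the adjoint relation.
  set J := (Lp.compMeasurePreservingₗᵢ ℝ (E := E) (p := 2) T hT).toContinuousLinearMap with hJ
  set V := J.adjoint (hf.toLp f) with hV
  refine ⟨V, (Lp.stronglyMeasurable V).measurable, Lp.memLp V, ?_, fun w hw => ?_⟩
  · rw [lintegral_enorm_sq_eq, lintegral_enorm_sq_eq]
    gcongr
    have hnorm : ‖V‖ ≤ ‖hf.toLp f‖ := by
      refine (J.adjoint.le_opNorm _).trans ?_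
      rw [LinearIsometryEquiv.norm_map]
      exact mul_le_of_le_one_left (norm_nonneg _) (LinearIsometry.norm_toContinuousLinearMap_le _)
    rw [Lp.norm_def, Lp.norm_toLp, ENNReal.toReal_le_toReal (Lp.eLpNorm_ne_top V) hf.2.ne] at hnorm
    exact hnorm
  · have hadj : inner ℝ (hw.toLp w) V = inner ℝ (J (hw.toLp w)) (hf.toLp f) :=
      ContinuousLinearMap.adjoint_inner_right J _ _
    rw [L2.inner_def, L2.inner_def] at hadj
    refine Eq.trans (integral_congr_ae ?_) (hadj.trans (integral_congr_ae ?_))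
    · filter_upwards [hw.coeFn_toLp] with y hy
      rw [hy]
    · have h1 : J (hw.toLp w) =ᵐ[μ] hw.toLp w ∘ T :=
        Lp.coeFn_compMeasurePreserving (hw.toLp w) hT
      have h2 : hw.toLp w ∘ T =ᵐ[μ] w ∘ T := hT.quasiMeasurePreserving.ae_eq_comp hw.coeFn_toLp
      filter_upwards [h1.trans h2, hf.coeFn_toLp] with x hx hx'
      rw [hx, hx']
      rfl

/-- Segments of the plan may cross with different velocities, but the weak equation only sees the
velocity paired with functions of (t, x), so the averaged field solves it. -/
theorem KFRsq_le_of_plan (hΩ : Convex ℝ Ω) {μ₀ μ₁ : PosMeas Ω} {γ : Measure (Ω × Ω)}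
    (hγ : γ ∈ Plans μ₀ μ₁)
    (hcost : ∫⁻ p, ‖(p.1 : Space d) - (p.2 : Space d)‖ₑ ^ 2 ∂γ < ⊤) :
    KFRsq μ₀ μ₁ ≤ ∫⁻ p, ‖(p.1 : Space d) - (p.2 : Space d)‖ₑ ^ 2 ∂γ := by
  -- Finiteness is not part of being a plan; it comes from the first marginal.
  have hfin : IsFiniteMeasure γ := by
    refine ⟨?_⟩
    rw [← preimage_univ (f := Prod.fst), ← Measure.map_apply measurable_fst .univ, hγ.1]
    exact measure_lt_top _ _
  set γ' : FiniteMeasure (Ω × Ω) := ⟨γ, hfin⟩ with hγ'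
  set I := volume.restrict (Ioo (0 : ℝ) 1) with hI
  set Λ := I.prod γ with hΛ
  set T : ℝ × (Ω × Ω) → ℝ × Ω := fun q => (q.1, interp hΩ q.1 q.2) with hTdef
  have hTc : Continuous T := continuous_fst.prodMk (continuous_interp hΩ)
  set ν := Λ.map T with hν
  have hT : MeasurePreserving T Λ ν := ⟨hTc.measurable, rfl⟩
  have hsec : ∀ t, Measurable (interp hΩ t) := fun t =>
    ((continuous_interp hΩ).comp (by fun_prop : Continuous fun p => (t, p))).measurable
  set f : ℝ × (Ω × Ω) → Space d := fun q => (q.2.2 : Space d) - q.2.1 with hf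
  have hfc : Continuous f := by fun_prop
  have hfcost : ∫⁻ q, ‖f q‖ₑ ^ 2 ∂Λ = ∫⁻ p, ‖(p.1 : Space d) - (p.2 : Space d)‖ₑ ^ 2 ∂γ := by
    rw [hΛ, lintegral_prod _ (by fun_prop)]
    simp [hf, hI, enorm_sub_rev]
  have hf2 : MemLp f 2 Λ := by
    refine ⟨hfc.aestronglyMeasurable, ?_⟩
    refine (eLpNorm_lt_top_iff_lintegral_rpow_enorm_lt_top two_ne_zero ENNReal.ofNat_ne_top).2 ?_
    refine lt_of_eq_of_lt ?_ (hfcost ▸ hcost)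
    simp
  obtain ⟨V, hVm, hV2, hVle, hVinner⟩ := exists_pushforward_field hT hf2
  have hlint : ∀ g : ℝ × Ω → ℝ≥0∞, Measurable g →
      ∫⁻ t in Ioo (0 : ℝ) 1, ∫⁻ x, g (t, x) ∂(displacement hΩ γ' t : Measure Ω) =
        ∫⁻ p, g p ∂ν := fun g hg => by
    rw [hν, lintegral_map hg hT.measurable, hΛ,
      lintegral_prod (fun q => g (T q)) (hg.comp hT.measurable).aemeasurable]
    refine lintegral_congr fun t => ?_
    rw [toMeasure_displacement, lintegral_map (by fun_prop) (hsec t)]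
    rfl
  have hint : ∀ g : ℝ × Ω → ℝ, Measurable g → Integrable g ν →
      ∫ t in Ioo (0 : ℝ) 1, ∫ x, g (t, x) ∂(displacement hΩ γ' t : Measure Ω) =
        ∫ p, g p ∂ν := fun g hg hgi => by
    rw [hν, integral_map hT.measurable.aemeasurable hg.aestronglyMeasurable, hΛ,
      integral_prod (fun q => g (T q)) (hgi.comp_measurable hT.measurable)]
    refine integral_congr_ae (Eventually.of_forall fun t => ?_)
    beta_reduce
    rw [toMeasure_displacement, integral_map (hsec t).aemeasurable
      (Measurable.aestronglyMeasurable (by fun_prop))]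
    rfl
  have hact : action (displacement hΩ γ') (fun t x => V (t, x)) (fun _ _ => 0) =
      ∫⁻ p, ‖V p‖ₑ ^ 2 ∂ν := by
    rw [← hlint _ (by fun_prop)]
    simp [action]
  have hactle := hact.trans_le (hVle.trans hfcost.le)
  have hν_fin : IsFiniteMeasure ν := by rw [hν]; infer_instance
  have hadm : IsAdmissible μ₀ μ₁ (displacement hΩ γ') (fun t x => V (t, x)) (fun _ _ => 0) := by
    refine ⟨(continuous_displacement hΩ γ').continuousOn, ?_, ?_, hVm, measurable_const,
      hactle.trans_lt hcost, ?_⟩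
    · refine Subtype.ext (Eq.trans (congrArg (Measure.map · γ) ?_) hγ.1)
      ext p : 2
      simp [coe_interp]
    · refine Subtype.ext (Eq.trans (congrArg (Measure.map · γ) ?_) hγ.2)
      ext p : 2
      simp [coe_interp]
    · intro φ hφ hφc hsupp
      have hcont : Continuous (fderiv ℝ φ) := hφ.continuous_fderiv (by simp)
      obtain ⟨C, hC⟩ := hcont.bounded_above_of_compact_support (hφc.fderiv (𝕜 := ℝ))
      have hdc : Continuous fun p : ℝ × Ω => fderiv ℝ φ (p.1, (p.2 : Space d)) :=
        hcont.comp (by fun_prop)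
      have hgi := integrable_weakIntegrand (M := ν) (v := fun t x => V (t, x))
        (r := fun _ _ => 0) (hV2.integrable (by norm_num)) (integrable_const 0) hφ hφc
      -- The spatial gradient of `φ` as a vector, in the form required by the pairing identity of
      -- the averaged field.
      set W : ℝ × Ω → Space d := fun p => (InnerProductSpace.toDual ℝ (Space d)).symm
        ((fderiv ℝ φ (p.1, (p.2 : Space d))).comp (ContinuousLinearMap.inr ℝ ℝ (Space d))) with hW
      have hWc : Continuous W := (LinearIsometryEquiv.continuous _).comp
        (hdc.clm_comp continuous_const)
      have hWapp : ∀ p y, inner ℝ (W p) y = fderiv ℝ φ (p.1, (p.2 : Space d)) (0, y) :=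
        fun p y => by simp [hW]
      have hWm : Measurable fun p : ℝ × Ω => fderiv ℝ φ (p.1, (p.2 : Space d)) (0, V p) := by
        simp only [← hWapp]
        exact hWc.measurable.inner hVm
      rw [hint (fun p : ℝ × Ω => fderiv ℝ φ (p.1, (p.2 : Space d)) (1, 0)
        + fderiv ℝ φ (p.1, (p.2 : Space d)) (0, V p) + φ (p.1, (p.2 : Space d)) * 0)
        (((hdc.clm_apply continuous_const).measurable.add hWm).add
          ((hφ.continuous.comp (by fun_prop)).measurable.mul_const 0)) hgi]
      have hWb : MemLp W 2 ν := by
        refine MemLp.of_bound hWc.aestronglyMeasurable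
          (C * ‖ContinuousLinearMap.inr ℝ ℝ (Space d)‖) (Eventually.of_forall fun p => ?_)
        rw [hW, LinearIsometryEquiv.norm_map]
        exact (ContinuousLinearMap.opNorm_comp_le _ _).trans (by gcongr; exact hC _)
      have hpair := hVinner W hWb
      simp only [hWapp] at hpair
      have hi1 : Integrable (fun p : ℝ × Ω => fderiv ℝ φ (p.1, (p.2 : Space d)) (1, 0)) ν := by
        refine Integrable.of_bound (hdc.clm_apply continuous_const).aestronglyMeasurable
          (C * ‖((1, 0) : ℝ × Space d)‖) (Eventually.of_forall fun p => ?_)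
        exact ((fderiv ℝ φ _).le_opNorm _).trans (by gcongr; exact hC _)
      have hi2 : Integrable (fun p : ℝ × Ω => fderiv ℝ φ (p.1, (p.2 : Space d)) (0, V p)) ν := by
        refine (hgi.sub hi1).congr (Eventually.of_forall fun p => ?_)
        simp
      have hdT : Continuous fun q => fderiv ℝ φ ((T q).1, ((T q).2 : Space d)) := hdc.comp hTc
      have hbound : ∀ w : ℝ × (Ω × Ω) → ℝ × Space d, Continuous w → Integrable w Λ →
          Integrable (fun q => fderiv ℝ φ ((T q).1, ((T q).2 : Space d)) (w q)) Λ := by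
        intro w hwc hw
        refine (hw.norm.const_mul C).mono' (hdT.clm_apply hwc).aestronglyMeasurable
          (Eventually.of_forall fun q => ?_)
        exact ((fderiv ℝ φ _).le_opNorm _).trans (by gcongr; exact hC _)
      have hfi : Integrable f Λ := hf2.integrable (by norm_num)
      simp only [mul_zero, add_zero]
      rw [integral_add hi1 hi2, hpair, hν,
        integral_map hT.measurable.aemeasurable (hν ▸ hi1.aestronglyMeasurable),
        ← integral_add (hbound _ continuous_const (integrable_const _))
          (hbound (fun q => (0, f q)) (by fun_prop) ((integrable_const (0 : ℝ)).prodMk hfi))]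
      -- Time and space parts merge into the derivative of `φ` in the direction (1, y - x), the
      -- total derivative along a segment; Fubini then integrates in time first.
      simp only [← map_add, Prod.mk_add_mk, add_zero, zero_add]
      rw [hΛ, integral_prod_symm _
        (hbound (fun q => (1, f q)) (by fun_prop) ((integrable_const (1 : ℝ)).prodMk hfi))]
      refine integral_eq_zero_of_ae (Eventually.of_forall fun p => ?_)
      refine Eq.trans (setIntegral_congr_fun measurableSet_Ioo fun t ht => ?_)
        (integral_fderiv_line_eq_zero hφ hsupp (p.1 : Space d) ((p.2 : Space d) - p.1))
      simp only [hTdef, hf, coe_interp hΩ (Ioo_subset_Icc_self ht)]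
  exact (iInf₂_le _ _).trans ((iInf₂_le _ hadm).trans hactle)

theorem KFRsq_le_MKsq (hΩ : Convex ℝ Ω) (μ₀ μ₁ : PosMeas Ω) : KFRsq μ₀ μ₁ ≤ MKsq μ₀ μ₁ := by
  refine le_iInf₂ fun γ hγ => ?_
  rcases eq_top_or_lt_top (∫⁻ p, ‖(p.1 : Space d) - (p.2 : Space d)‖ₑ ^ 2 ∂γ) with h | h
  · rw [h]; exact le_top
  · exact KFRsq_le_of_plan hΩ hγ h

/-! ### Energy dissipation and telescoping -/

theorem ereal_tsum_le_sub_iInf {X : Type*} (F : X → EReal) (hF_bot : ∀ x, F x ≠ ⊥)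
    (hF_proper : ∃ x, F x ≠ ⊤) (x : ℕ → X) (a : ℕ → ℝ≥0∞)
    (h : ∀ n, ((a n : ℝ≥0∞) : EReal) + F (x (n + 1)) ≤ F (x n)) :
    ((∑' n, a n : ℝ≥0∞) : EReal) ≤ F (x 0) - ⨅ y, F y := by
  obtain ⟨y, hy⟩ := hF_proper
  have hinf : (⨅ y, F y) ≠ ⊤ := fun h => hy (top_le_iff.1 (h ▸ iInf_le F y))
  have hpart : ∀ N, ((∑ n ∈ Finset.range N, a n : ℝ≥0∞) : EReal) + F (x N) ≤ F (x 0) := by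
    intro N
    induction N with
    | zero => simp
    | succ N ih =>
      refine le_trans ?_ ih
      rw [Finset.sum_range_succ, EReal.coe_ennreal_add, add_assoc]
      gcongr
      exact h N
  have hsub : ∀ N, ((∑ n ∈ Finset.range N, a n : ℝ≥0∞) : EReal) ≤ F (x 0) - ⨅ y, F y := by
    intro N
    -- The side conditions exclude ⊥ - ⊥ and ⊤ - ⊤, which would both equal ⊥.
    refine (EReal.le_sub_iff_add_le (Or.inr (hF_bot _)) (Or.inl hinf)).2 ?_
    exact le_trans (by gcongr; exact iInf_le F _) (hpart N)
  have hnonneg : 0 ≤ F (x 0) - ⨅ y, F y := by simpa using hsub 0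
  -- The empty partial sum shows the bound to be nonnegative, so the supremum can be taken in
  -- `ℝ≥0∞`.
  rw [← EReal.coe_toENNReal hnonneg, EReal.coe_ennreal_le_coe_ennreal_iff,
    ENNReal.tsum_eq_iSup_nat]
  refine iSup_le fun N => ?_
  rw [← EReal.coe_ennreal_le_coe_ennreal_iff, EReal.coe_toENNReal hnonneg]
  exact hsub N

theorem MKsq_self (μ : PosMeas Ω) : MKsq μ μ = 0 := by
  have hplan : (μ : Measure Ω).map (fun x => (x, x)) ∈ Plans μ μ := by
    constructor <;>
    · rw [Measure.map_map (by fun_prop) (by fun_prop)]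
      exact Measure.map_id
  refine le_antisymm ((iInf₂_le _ hplan).trans ?_) bot_le
  rw [lintegral_map (by fun_prop) (by fun_prop)]
  simp

theorem KFRsq_le_FRsq (μ₀ μ₁ : PosMeas Ω) : KFRsq μ₀ μ₁ ≤ FRsq μ₀ μ₁ := by
  refine le_iInf₂ fun ρ r => le_iInf fun h => ?_
  refine (iInf₂_le ρ _).trans ((iInf₂_le r h).trans ?_)
  simp [action]

/-- The competitors are `ρ n` in the transport step, allowed by its finite second moment and equal
mass, and `ρhalf n` in the reaction step. -/
theorem IsSplittingScheme.step_le {τ : ℝ} {F : PosMeas Ω → EReal} {ρ ρhalf : ℕ → PosMeas Ω}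
    (hρ : IsSplittingScheme τ F ρ ρhalf) (n : ℕ) :
    ((ENNReal.ofReal (1 / (2 * τ)) * (FRsq (ρ (n + 1)) (ρhalf n) + MKsq (ρhalf n) (ρ n)) :
      ℝ≥0∞) : EReal) + F (ρ (n + 1)) ≤ F (ρ n) := by
  obtain ⟨⟨h2, -, hMK⟩, -, hFR⟩ := hρ n
  have h1 := hMK (ρ n) ⟨h2, rfl⟩
  have h3 := hFR (ρhalf n) (mem_univ _)
  simp only [MKsq_self, FRsq_self, mul_zero, EReal.coe_ennreal_zero, zero_add] at h1 h3
  rw [mul_add, EReal.coe_ennreal_add, add_comm ((_ : ℝ≥0∞) : EReal), add_assoc]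
  refine le_trans ?_ h1
  gcongr

end

end KFRSplitting

theorem mainTheorem8 {d : ℕ} (Ω : Set (KFRSplitting.Space d)) (hΩ : Convex ℝ Ω)
    (F : KFRSplitting.PosMeas Ω → EReal) (hF_bot : ∀ μ, F μ ≠ ⊥) (hF_proper : ∃ μ, F μ ≠ ⊤)
    (τ : ℝ) (hτ : 0 < τ) (ρ ρhalf : ℕ → KFRSplitting.PosMeas Ω)
    (hρ : KFRSplitting.IsSplittingScheme τ F ρ ρhalf) :
    ((ENNReal.ofReal (1 / τ) * ∑' n : ℕ, KFRSplitting.KFRsq (ρ (n + 1)) (ρ n) : ℝ≥0∞) : EReal)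
        ≤ 4 * (F (ρ 0) - ⨅ μ, F μ)
    ∧ ((ENNReal.ofReal (1 / τ) * ∑' n : ℕ, (KFRSplitting.FRsq (ρ (n + 1)) (ρhalf n)
          + KFRSplitting.MKsq (ρhalf n) (ρ n)) : ℝ≥0∞) : EReal)
        ≤ 2 * (F (ρ 0) - ⨅ μ, F μ) := by
  have key := KFRSplitting.ereal_tsum_le_sub_iInf F hF_bot hF_proper ρ _ hρ.step_le
  rw [ENNReal.tsum_mul_left] at key
  -- Source of the constant 2 of the second bound; the relaxed triangle inequality doubles it to 4
  -- in the first.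
  have hτ2 : ENNReal.ofReal (1 / τ) = 2 * ENNReal.ofReal (1 / (2 * τ)) := by
    rw [show (2 : ℝ≥0∞) = ENNReal.ofReal 2 by simp, ← ENNReal.ofReal_mul (by norm_num)]
    congr 1
    field_simp
  have h2 : ((ENNReal.ofReal (1 / τ) * ∑' n : ℕ, (KFRSplitting.FRsq (ρ (n + 1)) (ρhalf n)
          + KFRSplitting.MKsq (ρhalf n) (ρ n)) : ℝ≥0∞) : EReal)
        ≤ 2 * (F (ρ 0) - ⨅ μ, F μ) := by
    rw [hτ2, mul_assoc, EReal.coe_ennreal_mul]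
    exact mul_le_mul_of_nonneg_left key zero_le_two
  refine ⟨?_, h2⟩
  have hK : ENNReal.ofReal (1 / τ) * ∑' n : ℕ, KFRSplitting.KFRsq (ρ (n + 1)) (ρ n)
      ≤ 2 * (ENNReal.ofReal (1 / τ) * ∑' n : ℕ, (KFRSplitting.FRsq (ρ (n + 1)) (ρhalf n)
          + KFRSplitting.MKsq (ρhalf n) (ρ n))) := by
    rw [mul_left_comm, ← ENNReal.tsum_mul_left (a := 2)]
    refine mul_le_mul_right (ENNReal.tsum_le_tsum fun n => ?_) _
    -- The intermediate point is `ρhalf n`, and the order of arguments matches that of the scheme,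
    -- so symmetry of the distances is not needed.
    refine (KFRSplitting.KFRsq_le_two_mul_add _ (ρhalf n) _).trans ?_
    gcongr
    · exact KFRSplitting.KFRsq_le_FRsq _ _
    · exact KFRSplitting.KFRsq_le_MKsq hΩ _ _
  refine (EReal.coe_ennreal_le_coe_ennreal_iff.2 hK).trans ?_
  rw [EReal.coe_ennreal_mul, show (4 : EReal) = 2 * 2 by norm_cast, mul_assoc]
  exact mul_le_mul_of_nonneg_left h2 zero_le_two
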